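/- Let $R$ be an integral domain with field of fractions $K$, and let $G=K^\times/R^\times$ be its divisibility group, ordered by divisibility and written multiplicatively. Let $P(G)$ be the set of nonempty finite subsets of $G$. *Definitions.* A system of ideals for $G$ is a relation $\rhd$ between $P(G)$ and $G$ such that, for all $A,A'\in P(G)$ and $a,b,c,x\in G$: $a\rhd a$; $A\rhd b$ implies $A\cup A'\rhd b$; $A\rhd c$ and $A\cup\{c\}\rhd b$ imply $A\rhd b$; $a\le b$ implies $a\rhd b$; $A\rhd b$ implies $xA\rhd xb$. The system of Dedekind ideals $\rhd_d$ is defined by: $A\rhd_d b$ iff $b$ lies in the fractional ideal $\langle A\rangle_R\subseteq K$ generated by (representatives of the elements of) $A$. For $y_1,\dots,y_m\in G$ let $(\rhd_d)_{y_1,\dots,y_m}$ be the finest system of ideals containing $\rhd_d$ in which $1\rhd y_i$ for $i=1,\dots,m$. The regularisation of $\rhd_d$ is the relation $\vdash$ on $P(G)$ for which $A\vdash B$ iff there are $m\ge 0$ and $x_1,\dots,x_m\in G$ such that $AB^{-1}\mathrel{(\rhd_d)_{x_1^{\pm1},\dots,x_m^{\pm1}}}1$ for every choice of signs. Let $\mathrm{Lor}(R)$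 be the distributive lattice (not required to be bounded) presented by generators $\varphi(a)$, $a\in G$, and relations $\bigwedge_{a\in A}\varphi(a)\le\bigvee_{b\in B}\varphi(b)$ whenever $A\vdash B$. An element $b\in K$ is integral over an $R$-submodule $I$ of $K$ if $b^p=\sum_{k=1}^p c_kb^{p-k}$ for some $p\ge1$ and $c_k\in I^k$. **Theorem.** The relation $\vdash$ is a regular entailment relation for $G$; that is, for all $A,A',B,B'\in P(G)$ and $a,b,c,x,y\in G$: $a\vdash a$; $A\vdash B$ implies $A\cup A'\vdash B\cup B'$; $A\vdash B\cup\{c\}$ and $A\cup\{c\}\vdash B$ imply $A\vdash B$; $a\le b$ implies $a\vdash b$; $A\vdash B$ implies $xA\vdash xB$; and $\{xa,yb\}\vdash\{ya,xb\}$. There is a unique commutative group law on $\mathrm{Lor}(R)$ that makes it a lattice-ordered group and for which $\varphi\colon G\to\mathrm{Lor}(R)$ is a group homomorphism; moreover $\varphi$ is order-preserving. With this structure $\mathrm{Lor}(R)$ is the Lorenzen divisor group of $R$, and the following hold. 1. For all $k\ge1$ and $a_1,\dots,a_k,b\in K^\times$ (writing $\varphi$ of an element of $K^\times$ for $\varphi$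 of its class), $$\varphi(a_1)\wedge\dots\wedge\varphi(a_k)\le\varphi(b)\iff b\text{ is integral over }\langle a_1,\dots,a_k\rangle_R .$$ 2. The morphism $\varphi$ is an embedding of ordered groups (i.e. it is injective and $\varphi(a)\le\varphi(b)\iff a\le b$ for all $a,b\in G$) if and only if $R$ is integrally closed. -/

import Mathlib

namespace LorenzenDivisor

open scoped Classical Pointwise

noncomputable section

universe u v

/-! ### Nonempty finite subsets -/

/-- The set of nonempty finite subsets of `G`. -/
def Pf (G : Type u) : Type u := {A : Finset G // A.Nonempty}

namespace Pf

variable {G : Type u}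

instance : Membership G (Pf G) := ⟨fun A a => a ∈ A.1⟩

instance : Union (Pf G) := ⟨fun A B => ⟨A.1 ∪ B.1, A.2.mono Finset.subset_union_left⟩⟩

instance : Singleton G (Pf G) := ⟨fun a => ⟨{a}, Finset.singleton_nonempty a⟩⟩

/-- The translate `x A = {x a | a ∈ A}`. -/
instance [CommGroup G] : SMul G (Pf G) := ⟨fun x A => ⟨A.1.image (x * ·), A.2.image _⟩⟩

/-- The set `A B⁻¹ = {a b⁻¹ | a ∈ A, b ∈ B}`. -/
instance [CommGroup G] : Div (Pf G) := ⟨fun A B => ⟨A.1 / B.1, A.2.div B.2⟩⟩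

end Pf

/-! ### Systems of ideals and regular entailment relations

Ordered groups are commutative and written multiplicatively. -/

section Entailment

variable {G : Type u}

/-- `r` is a system of ideals for the ordered group `G`: a single-conclusion entailment relation
that preserves the order and is equivariant. -/
structure IsSystemOfIdeals [CommGroup G] [PartialOrder G] (r : Pf G → G → Prop) : Prop where
  refl : ∀ a, r {a} a
  mono : ∀ A A' b, r A b → r (A ∪ A') b
  trans : ∀ A b c, r A c → r (A ∪ {c}) b → r A b
  order : ∀ a b, a ≤ b → r {a} b
  equivariant : ∀ (x : G) A b, r A b → r (x • A) (x * b)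

/-- `r` is a regular entailment relation for the ordered group `G`: an unbounded entailment
relation that preserves the order, is equivariant, and is regular. -/
structure IsRegularEntailment [CommGroup G] [PartialOrder G] (r : Pf G → Pf G → Prop) :
    Prop where
  refl : ∀ a, r {a} {a}
  mono : ∀ A A' B B', r A B → r (A ∪ A') (B ∪ B')
  trans : ∀ A B c, r A (B ∪ {c}) → r (A ∪ {c}) B → r A B
  order : ∀ a b, a ≤ b → r {a} {b}
  equivariant : ∀ (x : G) A B, r A B → r (x • A) (x • B)
  regular : ∀ x y a b, r ({x * a} ∪ {y * b}) ({y * a} ∪ {x * b})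

/-- The system of ideals obtained from `r` by forcing `1 ▷ y` for all `y ∈ Y`: the finest system
of ideals coarser than `r` in which these relations hold. -/
def forced [CommGroup G] [PartialOrder G] (r : Pf G → G → Prop) (Y : Set G) :
    Pf G → G → Prop := fun A b =>
  ∀ r' : Pf G → G → Prop, IsSystemOfIdeals r' → (∀ A b, r A b → r' A b) →
    (∀ y ∈ Y, r' {1} y) → r' A b

/-- The regularisation of `r`: `A ⊢ B` holds if there are `x₁, …, xₘ` such that for every choice of
signs `A B⁻¹ ▷ 1` holds in the system obtained by forcing `1 ▷ xᵢ^(±1)` for `i = 1, …, m`. -/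
def regularisation [CommGroup G] [PartialOrder G] (r : Pf G → G → Prop) :
    Pf G → Pf G → Prop := fun A B =>
  ∃ (m : ℕ) (x : Fin m → G), ∀ ε : Fin m → ℤˣ,
    forced r (Set.range fun i => x i ^ (ε i : ℤ)) (A / B) 1

end Entailment

/-! ### The distributive lattice generated by a relation -/

section Generated

variable {G : Type u}

/-- Formal lattice expressions in the generators `G`. -/
inductive LatticeTerm (G : Type u) : Type u
  | of : G → LatticeTerm G
  | inf : LatticeTerm G → LatticeTerm G → LatticeTerm G
  | sup : LatticeTerm G → LatticeTerm G → LatticeTerm G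

/-- The inequalities between lattice expressions that follow from the axioms of distributive
lattices and the relations `⋀ A ≤ ⋁ B` for `r A B`. The constructor `rel` expresses
`s ≤ ⋀ A ≤ ⋁ B ≤ t`. -/
inductive LatticeTerm.Le (r : Pf G → Pf G → Prop) : LatticeTerm G → LatticeTerm G → Prop
  | refl (s) : Le r s s
  | trans (s t w) : Le r s t → Le r t w → Le r s w
  | inf_le_left (s t) : Le r (.inf s t) s
  | inf_le_right (s t) : Le r (.inf s t) t
  | le_inf (s t w) : Le r s t → Le r s w → Le r s (.inf t w)
  | le_sup_left (s t) : Le r s (.sup s t)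
  | le_sup_right (s t) : Le r t (.sup s t)
  | sup_le (s t w) : Le r s w → Le r t w → Le r (.sup s t) w
  | distrib (s t w) : Le r (.inf (.sup s t) (.sup s w)) (.sup s (.inf t w))
  | rel (A B : Pf G) (s t) : r A B → (∀ a ∈ A, Le r s (.of a)) → (∀ b ∈ B, Le r (.of b) t) →
      Le r s t

/-- Two lattice expressions are identified if each is below the other. -/
def latticeSetoid (r : Pf G → Pf G → Prop) : Setoid (LatticeTerm G) where
  r s t := LatticeTerm.Le r s t ∧ LatticeTerm.Le r t s
  iseqv := ⟨fun s => ⟨.refl s, .refl s⟩, fun h => ⟨h.2, h.1⟩,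
    fun h h' => ⟨.trans _ _ _ h.1 h'.1, .trans _ _ _ h'.2 h.2⟩⟩

/-- The distributive lattice generated by `r`: its generators are the elements of `G` and its
relations are `⋀ A ≤ ⋁ B` whenever `r A B`. -/
def GeneratedLattice (r : Pf G → Pf G → Prop) : Type u := Quotient (latticeSetoid r)

namespace GeneratedLattice

variable (r : Pf G → Pf G → Prop)

instance : PartialOrder (GeneratedLattice r) where
  le := Quotient.lift₂ (LatticeTerm.Le r) fun _ _ _ _ h h' => propext
    ⟨fun k => .trans _ _ _ h.2 (.trans _ _ _ k h'.1),
      fun k => .trans _ _ _ h.1 (.trans _ _ _ k h'.2)⟩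
  le_refl := by rintro ⟨s⟩; exact .refl s
  le_trans := by rintro ⟨s⟩ ⟨t⟩ ⟨w⟩ h h'; exact .trans _ _ _ h h'
  le_antisymm := by rintro ⟨s⟩ ⟨t⟩ h h'; exact Quotient.sound ⟨h, h'⟩

instance : Lattice (GeneratedLattice r) where
  inf := Quotient.map₂ .inf fun _ _ h _ _ h' =>
    ⟨.le_inf _ _ _ (.trans _ _ _ (.inf_le_left _ _) h.1) (.trans _ _ _ (.inf_le_right _ _) h'.1),
      .le_inf _ _ _ (.trans _ _ _ (.inf_le_left _ _) h.2) (.trans _ _ _ (.inf_le_right _ _) h'.2)⟩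
  sup := Quotient.map₂ .sup fun _ _ h _ _ h' =>
    ⟨.sup_le _ _ _ (.trans _ _ _ h.1 (.le_sup_left _ _)) (.trans _ _ _ h'.1 (.le_sup_right _ _)),
      .sup_le _ _ _ (.trans _ _ _ h.2 (.le_sup_left _ _)) (.trans _ _ _ h'.2 (.le_sup_right _ _))⟩
  inf_le_left := by rintro ⟨s⟩ ⟨t⟩; exact .inf_le_left s t
  inf_le_right := by rintro ⟨s⟩ ⟨t⟩; exact .inf_le_right s t
  le_inf := by rintro ⟨s⟩ ⟨t⟩ ⟨w⟩ h h'; exact .le_inf _ _ _ h h'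
  le_sup_left := by rintro ⟨s⟩ ⟨t⟩; exact .le_sup_left s t
  le_sup_right := by rintro ⟨s⟩ ⟨t⟩; exact .le_sup_right s t
  sup_le := by rintro ⟨s⟩ ⟨t⟩ ⟨w⟩ h h'; exact .sup_le _ _ _ h h'

instance : DistribLattice (GeneratedLattice r) where
  le_sup_inf := by rintro ⟨s⟩ ⟨t⟩ ⟨w⟩; exact .distrib s t w

/-- The natural map from `G` to the distributive lattice generated by `r`. -/
def of (a : G) : GeneratedLattice r := Quotient.mk _ (.of a)

end GeneratedLattice

end Generated

/-! ### The divisibility group and the system of Dedekind ideals -/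

section Domain

variable (R : Type u) (K : Type v) [CommRing R] [Field K] [Algebra R K]

/-- The divisibility group `Kˣ / Rˣ` of `R`. -/
def DivisibilityGroup : Type v := Kˣ ⧸ (Units.map (algebraMap R K : R →* K)).range

instance : CommGroup (DivisibilityGroup R K) :=
  inferInstanceAs (CommGroup (Kˣ ⧸ (Units.map (algebraMap R K : R →* K)).range))

/-- The class in the divisibility group of a nonzero element of `K`. -/
def DivisibilityGroup.mk : Kˣ →* DivisibilityGroup R K := QuotientGroup.mk' _

namespace DivisibilityGroup

/-- The divisibility relation: `a ≤ b` if `v = r u` for some `r` in `R` and some representatives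
`u` of `a` and `v` of `b`. -/
instance : LE (DivisibilityGroup R K) :=
  ⟨fun a b => ∃ (u v : Kˣ) (r : R), mk R K u = a ∧ mk R K v = b ∧ (v : K) = algebraMap R K r * u⟩

theorem mk_le_mk (u v : Kˣ) :
    mk R K u ≤ mk R K v ↔ ∃ r : R, (v : K) = algebraMap R K r * u := by
  constructor
  · rintro ⟨u', v', r, hu, hv, h⟩
    obtain ⟨w, hw⟩ := QuotientGroup.eq.1 hu
    obtain ⟨z, hz⟩ := QuotientGroup.eq.1 hv
    have hw' : (u : K) = u' * algebraMap R K w := by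
      have := congrArg (fun t : Kˣ => ((u' * t : Kˣ) : K)) hw
      simpa using this.symm
    have hz' : (v : K) = v' * algebraMap R K z := by
      have := congrArg (fun t : Kˣ => ((v' * t : Kˣ) : K)) hz
      simpa using this.symm
    refine ⟨r * z * ((w⁻¹ : Rˣ) : R), ?_⟩
    have hww : algebraMap R K w * algebraMap R K ((w⁻¹ : Rˣ) : R) = 1 := by
      rw [← map_mul]; simp
    rw [hz', hw', h, map_mul, map_mul]
    linear_combination (-(algebraMap R K r * algebraMap R K z * u')) * hww
  · rintro ⟨r, h⟩
    exact ⟨u, v, r, rfl, rfl, h⟩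

variable [IsFractionRing R K]

instance : PartialOrder (DivisibilityGroup R K) where
  le_refl a := by
    obtain ⟨u, rfl⟩ := QuotientGroup.mk'_surjective _ a
    exact (mk_le_mk R K u u).2 ⟨1, by simp⟩
  le_trans a b c h h' := by
    obtain ⟨u, rfl⟩ := QuotientGroup.mk'_surjective _ a
    obtain ⟨v, rfl⟩ := QuotientGroup.mk'_surjective _ b
    obtain ⟨w, rfl⟩ := QuotientGroup.mk'_surjective _ c
    obtain ⟨r, hr⟩ := (mk_le_mk R K u v).1 h
    obtain ⟨s, hs⟩ := (mk_le_mk R K v w).1 h'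
    exact (mk_le_mk R K u w).2 ⟨s * r, by rw [hs, hr, map_mul, mul_assoc]⟩
  le_antisymm a b h h' := by
    obtain ⟨u, rfl⟩ := QuotientGroup.mk'_surjective _ a
    obtain ⟨v, rfl⟩ := QuotientGroup.mk'_surjective _ b
    obtain ⟨r, hr⟩ := (mk_le_mk R K u v).1 h
    obtain ⟨s, hs⟩ := (mk_le_mk R K v u).1 h'
    have h1 : r * s = 1 := by
      apply IsFractionRing.injective R K
      have h2 : algebraMap R K r * algebraMap R K s * (v : K) = 1 * v := by
        conv_rhs => rw [hr, hs]
        ring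
      rw [map_mul, map_one]
      exact mul_right_cancel₀ v.ne_zero h2
    refine QuotientGroup.eq.2 ⟨Units.mkOfMulEqOne r s h1, ?_⟩
    rw [eq_inv_mul_iff_mul_eq]
    ext
    simp [hr, mul_comm]

instance : IsOrderedMonoid (DivisibilityGroup R K) where
  mul_le_mul_left a b h c := by
    obtain ⟨u, rfl⟩ := QuotientGroup.mk'_surjective _ a
    obtain ⟨v, rfl⟩ := QuotientGroup.mk'_surjective _ b
    obtain ⟨w, rfl⟩ := QuotientGroup.mk'_surjective _ c
    obtain ⟨r, hr⟩ := (mk_le_mk R K u v).1 h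
    refine (mk_le_mk R K (u * w) (v * w)).2 ⟨r, ?_⟩
    rw [Units.val_mul, Units.val_mul, hr, mul_assoc]

end DivisibilityGroup

variable [IsFractionRing R K]

/-- The system of Dedekind ideals: `A ▷ b` if `b` lies in the fractional ideal generated by `A`
over `R` in `K`. -/
def dedekind : Pf (DivisibilityGroup R K) → DivisibilityGroup R K → Prop := fun A b =>
  ∀ u : Kˣ, DivisibilityGroup.mk R K u = b →
    (u : K) ∈ Submodule.span R ((fun v : Kˣ => (v : K)) '' {v | DivisibilityGroup.mk R K v ∈ A})

/-- The underlying distributive lattice of the Lorenzen divisor group of `R`: the distributive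
lattice generated by the regularisation of the system of Dedekind ideals. -/
abbrev Lor : Type v := GeneratedLattice (regularisation (dedekind R K))

/-- The natural map `φ` from the divisibility group to the Lorenzen divisor group. -/
def toLor : DivisibilityGroup R K → Lor R K := GeneratedLattice.of _

/-- A group law on `Lor R K` that is compatible with the lattice structure and makes the natural
map a morphism of groups. -/
structure IsLorenzenGroupLaw (g : CommGroup (Lor R K)) : Prop where
  isOrderedMonoid : IsOrderedMonoid (Lor R K)
  map_mul : ∀ a b, toLor R K (a * b) = toLor R K a * toLor R K b

variable {K} in
/-- The element `b` of `K` is integral over the fractional ideal `I`: there is an equation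
`b ^ p = ∑_{k = 1}^p c_k b ^ (p - k)` with `p ≥ 1` and `c_k ∈ I ^ k`. -/
def IsIntegralOverIdeal (I : Submodule R K) (b : K) : Prop :=
  ∃ p : ℕ, 1 ≤ p ∧ ∃ c : ℕ → K, (∀ k ∈ Finset.Icc 1 p, c k ∈ I ^ k) ∧
    b ^ p = ∑ k ∈ Finset.Icc 1 p, c k * b ^ (p - k)

end Domain

end

end LorenzenDivisor

namespace LorenzenDivisor

open scoped Classical Pointwise

noncomputable section

universe u v w

/-! ### Entailment evaluated in linearly ordered groups -/

section Entailment

variable {G : Type u}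

/-! Everything reduces to valuations: `A ⊢ B` holds iff for every valuation ring `V` of `K`
containing `R` some `a ∈ A` lies below some `b ∈ B` in the value group of `V`
(`regularisation_dedekind_iff`). Soundness: given `V`, choose the signs so that the forced elements
have value at least `1`. Completeness: force signs on the elements of `C = A / B` and on their
quotients. The forced elements generate a ring `S` over which some `c ∈ C` divides all the others;
if `c⁻¹ ∉ S`, a valuation centred at `(c)` contradicts the hypothesis, and if `c⁻¹ ∈ S` then `1 =
c⁻¹ c` is generated by `C`.

The relation is therefore regular, since linear orders are, and `Lor R K` embeds into the product of
the value groups (`lift_le_lift`). Its image is the sublattice generated by a subgroup, hence itself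
a subgroup, which gives the group law. Both statements on integrality then become valuative criteria
(`isIntegralOverIdeal_iff`, `isIntegral_iff_forall_valuationOver`). -/

theorem Pf.mem_union {A B : Pf G} {a : G} : a ∈ A ∪ B ↔ a ∈ A ∨ a ∈ B :=
  Finset.mem_union

theorem Pf.mem_singleton {a b : G} : b ∈ ({a} : Pf G) ↔ b = a :=
  Finset.mem_singleton

theorem Pf.mem_smul [CommGroup G] {x b : G} {A : Pf G} : b ∈ x • A ↔ ∃ a ∈ A, x * a = b :=
  Finset.mem_image

theorem Pf.mem_div [CommGroup G] {b : G} {A B : Pf G} :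
    b ∈ A / B ↔ ∃ a ∈ A, ∃ c ∈ B, a / c = b :=
  Finset.mem_div

theorem Pf.ext {A B : Pf G} (h : ∀ a, a ∈ A ↔ a ∈ B) : A = B :=
  Subtype.ext (Finset.ext h)

variable {ι : Type w} {H : ι → Type v} [∀ i, CommGroup (H i)] [∀ i, LinearOrder (H i)]

/-- The relation `⋀ A ≤ ⋁ B` evaluated in a family of linearly ordered sets. -/
def SemanticEntailment (f : ∀ i, G → H i) (A B : Pf G) : Prop :=
  ∀ i, ∃ a ∈ A, ∃ b ∈ B, f i a ≤ f i b

/-- Each axiom is checked in one coordinate at a time. Regularity is where linearity enters: compare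
the images of `x` and `y`, then multiply by that of `a` or `b`. -/
theorem isRegularEntailment_semanticEntailment [CommGroup G] [PartialOrder G]
    [∀ i, IsOrderedMonoid (H i)] {f : ∀ i, G →* H i} (hf : ∀ i, Monotone (f i)) :
    IsRegularEntailment (SemanticEntailment fun i => f i) where
  refl a i := ⟨a, Pf.mem_singleton.2 rfl, a, Pf.mem_singleton.2 rfl, le_rfl⟩
  mono A A' B B' h i := by
    obtain ⟨a, ha, b, hb, hab⟩ := h i
    exact ⟨a, Pf.mem_union.2 (.inl ha), b, Pf.mem_union.2 (.inl hb), hab⟩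
  trans A B c h h' i := by
    obtain ⟨a, ha, b, hb, hab⟩ := h i
    obtain ⟨a', ha', b', hb', hab'⟩ := h' i
    rcases Pf.mem_union.1 hb with hb | hb
    · exact ⟨a, ha, b, hb, hab⟩
    rcases Pf.mem_union.1 ha' with ha' | ha'
    · exact ⟨a', ha', b', hb', hab'⟩
    rw [Pf.mem_singleton.1 hb] at hab
    rw [Pf.mem_singleton.1 ha'] at hab'
    exact ⟨a, ha, b', hb', hab.trans hab'⟩
  order a b h i := ⟨a, Pf.mem_singleton.2 rfl, b, Pf.mem_singleton.2 rfl, hf i h⟩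
  equivariant x A B h i := by
    obtain ⟨a, ha, b, hb, hab⟩ := h i
    refine ⟨x * a, Pf.mem_smul.2 ⟨a, ha, rfl⟩, x * b, Pf.mem_smul.2 ⟨b, hb, rfl⟩, ?_⟩
    change f i _ ≤ f i _
    rw [map_mul, map_mul]
    exact mul_le_mul_right hab _
  regular x y a b i := by
    rcases le_total (f i x) (f i y) with h | h
    · refine ⟨x * a, Pf.mem_union.2 (.inl (Pf.mem_singleton.2 rfl)), y * a,
        Pf.mem_union.2 (.inl (Pf.mem_singleton.2 rfl)), ?_⟩
      change f i _ ≤ f i _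
      rw [map_mul, map_mul]
      exact mul_le_mul_left h _
    · refine ⟨y * b, Pf.mem_union.2 (.inr (Pf.mem_singleton.2 rfl)), x * b,
        Pf.mem_union.2 (.inr (Pf.mem_singleton.2 rfl)), ?_⟩
      change f i _ ≤ f i _
      rw [map_mul, map_mul]
      exact mul_le_mul_left h _

end Entailment

/-! ### Embedding of the generated lattice into a product of chains -/

section Evaluation

variable {G : Type u}

/-- The value of a lattice expression under an assignment of its generators. -/
def LatticeTerm.eval {L : Type v} [Lattice L] (f : G → L) : LatticeTerm G → L
  | .of a => f a
  | .inf s t => s.eval f ⊓ t.eval f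
  | .sup s t => s.eval f ⊔ t.eval f

namespace GeneratedLattice

theorem induction {r : Pf G → Pf G → Prop} {p : GeneratedLattice r → Prop}
    (of : ∀ a, p (of r a)) (inf : ∀ x y, p x → p y → p (x ⊓ y))
    (sup : ∀ x y, p x → p y → p (x ⊔ y)) (x : GeneratedLattice r) : p x := by
  obtain ⟨s⟩ := x
  induction s with
  | of a => exact of a
  | inf s t hs ht => exact inf _ _ hs ht
  | sup s t hs ht => exact sup _ _ hs ht

theorem le_of_rel {r : Pf G → Pf G → Prop} {A B : Pf G} (h : r A B) {x y : GeneratedLattice r}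
    (hx : ∀ a ∈ A, x ≤ of r a) (hy : ∀ b ∈ B, of r b ≤ y) : x ≤ y := by
  obtain ⟨s⟩ := x
  obtain ⟨t⟩ := y
  exact LatticeTerm.Le.rel A B s t h hx hy

theorem latticeClosure_range_of (r : Pf G → Pf G → Prop) :
    latticeClosure (Set.range (of r)) = Set.univ := by
  refine Set.eq_univ_of_forall fun x => ?_
  induction x using induction with
  | of a => exact subset_latticeClosure ⟨a, rfl⟩
  | inf x y hx hy => exact isSublattice_latticeClosure.2 hx hy
  | sup x y hx hy => exact isSublattice_latticeClosure.1 hx hy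

variable {ι : Type w} {H : ι → Type v} [∀ i, LinearOrder (H i)] {r : Pf G → Pf G → Prop}
  {f : ∀ i, G → H i}

theorem eval_le_eval (hr : ∀ A B, r A B → SemanticEntailment f A B) {s t : LatticeTerm G}
    (h : LatticeTerm.Le r s t) :
    s.eval (fun a i => f i a) ≤ t.eval (fun a i => f i a) := by
  induction h with
  | refl s => exact le_rfl
  | trans s t w _ _ h h' => exact h.trans h'
  | inf_le_left s t => exact inf_le_left
  | inf_le_right s t => exact inf_le_right
  | le_inf s t w _ _ h h' => exact le_inf h h'
  | le_sup_left s t => exact le_sup_left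
  | le_sup_right s t => exact le_sup_right
  | sup_le s t w _ _ h h' => exact sup_le h h'
  | distrib s t w => exact le_sup_inf
  | rel A B s t h _ _ hs ht =>
    intro i
    obtain ⟨a, ha, b, hb, hab⟩ := hr A B h i
    exact (hs a ha i).trans (hab.trans (ht b hb i))

/-- The lattice homomorphism extending an assignment of the generators that respects the
relations. -/
def lift (hr : ∀ A B, r A B → SemanticEntailment f A B) :
    LatticeHom (GeneratedLattice r) (∀ i, H i) where
  toFun := Quotient.lift (LatticeTerm.eval fun a i => f i a) fun _ _ h =>
    le_antisymm (eval_le_eval hr h.1) (eval_le_eval hr h.2)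
  map_sup' := by rintro ⟨s⟩ ⟨t⟩; rfl
  map_inf' := by rintro ⟨s⟩ ⟨t⟩; rfl

theorem rel_of_le (hr : ∀ A B, r A B → SemanticEntailment f A B) {S T : Finset G}
    (hS : S.Nonempty) (hT : T.Nonempty)
    (h : lift hr (S.inf' hS (of r)) ≤ lift hr (T.sup' hT (of r))) :
    SemanticEntailment f ⟨S, hS⟩ ⟨T, hT⟩ := by
  intro i
  rw [map_finset_inf', map_finset_sup'] at h
  have h := h i
  rw [Finset.inf'_apply, Finset.sup'_apply] at h
  -- In a chain, finite infima and suprema are attained.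
  obtain ⟨a, ha, hae⟩ := Finset.exists_mem_eq_inf' hS fun a => (lift hr ∘ of r) a i
  obtain ⟨b, hb, hbe⟩ := Finset.exists_mem_eq_sup' hT fun a => (lift hr ∘ of r) a i
  rw [hae, hbe] at h
  exact ⟨a, ha, b, hb, h⟩

theorem exists_eq_inf' {s : Finset (GeneratedLattice r)} (hs : s.Nonempty)
    (h : ↑s ⊆ Set.range (of r)) :
    ∃ (S : Finset G) (hS : S.Nonempty), s.inf' hs id = S.inf' hS (of r) ∧
      s.sup' hs id = S.sup' hS (of r) := by
  rw [← Set.image_univ, Finset.subset_set_image_iff] at h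
  obtain ⟨S, -, rfl⟩ := h
  have hS := Finset.image_nonempty.1 hs
  exact ⟨S, hS, by rw [Finset.inf'_image]; rfl, by rw [Finset.sup'_image]; rfl⟩

/-- By distributivity `x` is a finite join of finite meets of generators and `y` a finite meet of
finite joins. This reduces the claim to `⋀ S ≤ ⋁ T`, where semantic entailment is itself a defining
relation. -/
theorem lift_le_lift (hr : ∀ A B, r A B ↔ SemanticEntailment f A B) {x y : GeneratedLattice r} :
    lift (fun A B => (hr A B).1) x ≤ lift (fun A B => (hr A B).1) y ↔ x ≤ y := by
  refine ⟨fun h => ?_, fun h => OrderHomClass.mono _ h⟩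
  have hx : x ∈ supClosure (infClosure (Set.range (of r))) := by
    rw [supClosure_infClosure, latticeClosure_range_of]; trivial
  have hy : y ∈ infClosure (supClosure (Set.range (of r))) := by
    rw [infClosure_supClosure, latticeClosure_range_of]; trivial
  obtain ⟨F, hF, hFs, rfl⟩ := hx
  obtain ⟨E, hE, hEs, rfl⟩ := hy
  refine Finset.sup'_le _ _ fun x hx => Finset.le_inf' _ _ fun y hy => ?_
  have hxy : lift (fun A B => (hr A B).1) x ≤ lift (fun A B => (hr A B).1) y :=
    (OrderHomClass.mono _ (Finset.le_sup' id hx)).trans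
      (h.trans (OrderHomClass.mono _ (Finset.inf'_le id hy)))
  obtain ⟨s, hs, hss, rfl⟩ := hFs hx
  obtain ⟨t, ht, hts, rfl⟩ := hEs hy
  obtain ⟨S, hS, h₁, -⟩ := exists_eq_inf' hs hss
  obtain ⟨T, hT, -, h₂⟩ := exists_eq_inf' ht hts
  rw [h₁, h₂] at hxy ⊢
  exact le_of_rel ((hr _ _).2 (rel_of_le _ hS hT hxy)) (fun a ha => Finset.inf'_le _ ha)
    fun b hb => Finset.le_sup' _ hb

theorem lift_injective (hr : ∀ A B, r A B ↔ SemanticEntailment f A B) :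
    Function.Injective (lift fun A B => (hr A B).1) := fun _ _ h =>
  le_antisymm ((lift_le_lift hr).1 h.le) ((lift_le_lift hr).1 h.ge)

end GeneratedLattice

end Evaluation

/-! ### The group law and its uniqueness -/

section GroupLaw

namespace GeneratedLattice

variable {G : Type u} [CommGroup G] {ι : Type w} {H : ι → Type v} [∀ i, CommGroup (H i)]
  [∀ i, LinearOrder (H i)] [∀ i, IsOrderedMonoid (H i)] {r : Pf G → Pf G → Prop}
  {f : ∀ i, G →* H i}

/-- Multiplication in the product distributes over `⊓` and `⊔`, so closure under products only needs
checking on generators, where it comes from `f`. -/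
theorem exists_lift_eq_mul (hr : ∀ A B, r A B → SemanticEntailment (fun i => f i) A B)
    (x y : GeneratedLattice r) : ∃ z, lift hr z = lift hr x * lift hr y := by
  induction x using induction with
  | of a =>
    induction y using induction with
    | of b => exact ⟨of r (a * b), funext fun i => map_mul (f i) a b⟩
    | inf y y' hy hy' =>
      obtain ⟨z, hz⟩ := hy
      obtain ⟨z', hz'⟩ := hy'
      exact ⟨z ⊓ z', by rw [map_inf, map_inf, mul_inf, hz, hz']⟩
    | sup y y' hy hy' =>
      obtain ⟨z, hz⟩ := hy
      obtain ⟨z', hz'⟩ := hy'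
      exact ⟨z ⊔ z', by rw [map_sup, map_sup, mul_sup, hz, hz']⟩
  | inf x x' hx hx' =>
    obtain ⟨z, hz⟩ := hx
    obtain ⟨z', hz'⟩ := hx'
    exact ⟨z ⊓ z', by rw [map_inf, map_inf, inf_mul, hz, hz']⟩
  | sup x x' hx hx' =>
    obtain ⟨z, hz⟩ := hx
    obtain ⟨z', hz'⟩ := hx'
    exact ⟨z ⊔ z', by rw [map_sup, map_sup, sup_mul, hz, hz']⟩

theorem exists_lift_eq_inv (hr : ∀ A B, r A B → SemanticEntailment (fun i => f i) A B)
    (x : GeneratedLattice r) : ∃ z, lift hr z = (lift hr x)⁻¹ := by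
  induction x using induction with
  | of a => exact ⟨of r a⁻¹, funext fun i => map_inv (f i) a⟩
  | inf x x' hx hx' =>
    obtain ⟨z, hz⟩ := hx
    obtain ⟨z', hz'⟩ := hx'
    exact ⟨z ⊔ z', by rw [map_inf, map_sup, inv_inf, hz, hz']⟩
  | sup x x' hx hx' =>
    obtain ⟨z, hz⟩ := hx
    obtain ⟨z', hz'⟩ := hx'
    exact ⟨z ⊓ z', by rw [map_sup, map_inf, inv_sup, hz, hz']⟩

/-- This gives uniqueness: any compatible law also distributes over `⊓` and `⊔`, so it is determined
by its values on generators. -/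
theorem lift_mul_of_map_mul (hr : ∀ A B, r A B → SemanticEntailment (fun i => f i) A B)
    [CommGroup (GeneratedLattice r)] [IsOrderedMonoid (GeneratedLattice r)]
    (h : ∀ a b, of r (a * b) = of r a * of r b) (x y : GeneratedLattice r) :
    lift hr (x * y) = lift hr x * lift hr y := by
  induction x using induction with
  | of a =>
    induction y using induction with
    | of b => rw [← h]; exact funext fun i => map_mul (f i) a b
    | inf y y' hy hy' => rw [mul_inf, map_inf, hy, hy', map_inf, mul_inf]
    | sup y y' hy hy' => rw [mul_sup, map_sup, hy, hy', map_sup, mul_sup]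
  | inf x x' hx hx' => rw [inf_mul, map_inf, hx, hx', map_inf, inf_mul]
  | sup x x' hx hx' => rw [sup_mul, map_sup, hx, hx', map_sup, sup_mul]

/-- The range of `lift`, a sublattice generated by a subgroup, as a subgroup. -/
def liftRange (hr : ∀ A B, r A B → SemanticEntailment (fun i => f i) A B) :
    Subgroup (∀ i, H i) where
  carrier := Set.range (lift hr)
  mul_mem' := by
    rintro _ _ ⟨x, rfl⟩ ⟨y, rfl⟩
    exact exists_lift_eq_mul hr x y
  one_mem' := ⟨of r 1, funext fun i => map_one (f i)⟩
  inv_mem' := by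
    rintro _ ⟨x, rfl⟩
    exact exists_lift_eq_inv hr x

theorem existsUnique_commGroup
    (hr : ∀ A B, r A B ↔ SemanticEntailment (fun i => f i) A B) :
    ∃! _g : CommGroup (GeneratedLattice r), IsOrderedMonoid (GeneratedLattice r) ∧
      ∀ a b, of r (a * b) = of r a * of r b := by
  have hinj := lift_injective hr
  let e : GeneratedLattice r ≃ liftRange fun A B => (hr A B).1 := Equiv.ofInjective _ hinj
  let _ : CommGroup (GeneratedLattice r) := e.commGroup
  have hmul (x y : GeneratedLattice r) : lift (fun A B => (hr A B).1) (x * y) =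
      lift (fun A B => (hr A B).1) x * lift (fun A B => (hr A B).1) y :=
    congrArg Subtype.val (e.apply_symm_apply (e x * e y))
  refine ⟨e.commGroup, ⟨{ mul_le_mul_left := fun x y h z => ?_ }, fun a b => hinj ?_⟩, fun g' h' => ?_⟩
  · rw [← lift_le_lift hr, hmul, hmul]
    exact mul_le_mul_left ((lift_le_lift hr).2 h) _
  · rw [hmul]
    exact funext fun i => map_mul (f i) a b
  · refine CommGroup.ext (funext fun x => funext fun y => hinj ?_)
    -- Makes the compatibility of the competing law with the order available as an instance.
    have := h'.1
    rw [lift_mul_of_map_mul _ h'.2]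
    exact (hmul x y).symm

end GeneratedLattice

end GroupLaw

/-! ### Valuation rings containing the domain -/

section Domain

variable (R : Type u) (K : Type v) [CommRing R] [Field K] [Algebra R K]

/-- The valuation rings of `K` that contain `R`. -/
abbrev ValuationOver : Type v := {V : ValuationSubring K // ∀ r : R, algebraMap R K r ∈ V}

variable {R K}

namespace ValuationOver

variable (V : ValuationOver R K)

/-- The value group of a valuation ring. -/
abbrev ValueGroup : Type v := V.1.ValueGroupˣ

/-- The morphism from the divisibility group to the value group, which is written so that the
elements of the valuation ring have values `≥ 1`. -/
def hom : DivisibilityGroup R K →* V.ValueGroup :=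
  QuotientGroup.lift _ ((Units.map (V.1.valuation : K →* V.1.ValueGroup))⁻¹) (by
    rintro _ ⟨w, rfl⟩
    rw [MonoidHom.mem_ker, MonoidHom.inv_apply, inv_eq_one]
    refine Units.ext (le_antisymm ((V.1.valuation_le_one_iff _).2 (V.2 w)) ?_)
    have h := (V.1.valuation_le_one_iff _).2 (V.2 ((w⁻¹ : Rˣ) : R))
    have h' : V.1.valuation (algebraMap R K w) *
        V.1.valuation (algebraMap R K ((w⁻¹ : Rˣ) : R)) = 1 := by
      rw [← map_mul, ← map_mul, Units.mul_inv, map_one, map_one]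
    exact h'.symm.trans_le (mul_le_of_le_one_right' h))

theorem hom_mk (u : Kˣ) : V.hom (DivisibilityGroup.mk R K u) =
    (Units.map (V.1.valuation : K →* V.1.ValueGroup) u)⁻¹ := rfl

theorem hom_mk_le_iff {a b : Kˣ} :
    V.hom (DivisibilityGroup.mk R K a) ≤ V.hom (DivisibilityGroup.mk R K b) ↔
      V.1.valuation b ≤ V.1.valuation a := by
  rw [hom_mk, hom_mk, inv_le_inv_iff]
  rfl

theorem hom_mk_lt_iff {a b : Kˣ} :
    V.hom (DivisibilityGroup.mk R K a) < V.hom (DivisibilityGroup.mk R K b) ↔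
      V.1.valuation b < V.1.valuation a := by
  rw [← not_le, hom_mk_le_iff, not_le]

theorem valuation_algebraMap_le_one (r : R) : V.1.valuation (algebraMap R K r) ≤ 1 :=
  (V.1.valuation_le_one_iff _).2 (V.2 r)

/-- An open ball around `0` is an `R`-submodule because `R ⊆ V`; `γ ≠ 0` ensures that it contains
`0`. -/
theorem valuation_lt_of_mem_span {T : Set K} {γ : V.1.ValueGroup} (hγ : γ ≠ 0)
    (h : ∀ t ∈ T, V.1.valuation t < γ) {x : K} (hx : x ∈ Submodule.span R T) :
    V.1.valuation x < γ := by
  induction hx using Submodule.span_induction with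
  | mem t ht => exact h t ht
  | zero => rw [map_zero]; exact zero_lt_iff.2 hγ
  | add x y _ _ hx hy => exact V.1.valuation.map_add_lt hx hy
  | smul r x _ hx =>
    rw [Algebra.smul_def, map_mul]
    exact (mul_le_of_le_one_left' (V.valuation_algebraMap_le_one r)).trans_lt hx

/-- The exponent is positive because the strict bound fails for `1 ∈ I ^ 0`. -/
theorem valuation_lt_of_mem_pow {I : Submodule R K} {γ : V.1.ValueGroup}
    (h : ∀ x ∈ I, V.1.valuation x < γ) (k : ℕ) {x : K} (hx : x ∈ I ^ (k + 1)) :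
    V.1.valuation x < γ ^ (k + 1) := by
  induction k generalizing x with
  | zero => simpa using h x (by simpa using hx)
  | succ k ih =>
    rw [pow_succ] at hx
    induction hx using Submodule.mul_induction_on' with
    | mem_mul_mem m hm n hn =>
      rw [map_mul, pow_succ]
      exact mul_lt_mul'' (ih hm) (h n hn) zero_le zero_le
    | add x _ y _ hx hy => exact V.1.valuation.map_add_lt hx hy

theorem hom_monotone [IsFractionRing R K] : Monotone V.hom := by
  intro a b h
  obtain ⟨u, rfl⟩ := QuotientGroup.mk'_surjective _ a
  obtain ⟨v, rfl⟩ := QuotientGroup.mk'_surjective _ b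
  obtain ⟨r, hr⟩ := (DivisibilityGroup.mk_le_mk R K u v).1 h
  refine V.hom_mk_le_iff.2 ?_
  rw [hr, map_mul]
  exact mul_le_of_le_one_left' (V.valuation_algebraMap_le_one r)

end ValuationOver

/-- A proper ideal of an intermediate ring is centred in some valuation ring. -/
theorem exists_valuationOver (S : Subalgebra R K) {I : Ideal S} (hI : I ≠ ⊤) :
    ∃ V : ValuationOver R K, (∀ x ∈ S, V.1.valuation x ≤ 1) ∧
      ∀ x ∈ I, V.1.valuation (x : K) < 1 := by
  obtain ⟨V, hSV, hIV⟩ := Ideal.image_subset_nonunits_valuationSubring (A := S.toSubring) I hI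
  exact ⟨⟨V, fun r => hSV (S.algebraMap_mem r)⟩, fun x hx => (V.valuation_le_one_iff x).2 (hSV hx),
    fun x hx => (V.mem_nonunits_iff).1 (hIV ⟨x, hx, rfl⟩)⟩

/-! ### Valuative criteria for integrality -/

section Integrality

/-- The sum of the positive powers of `⟨C⟩` is stable under `R[C]`. Hence it contains the ideal of
`R[C]` generated by `C`. -/
theorem mul_mem_iSup_pow {C : Set K} {s t : K} (hs : s ∈ Algebra.adjoin R C)
    (ht : t ∈ ⨆ k : ℕ, Submodule.span R C ^ (k + 1)) :
    s * t ∈ ⨆ k : ℕ, Submodule.span R C ^ (k + 1) := by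
  induction hs using Algebra.adjoin_induction generalizing t with
  | mem c hc =>
    suffices h : (⨆ k : ℕ, Submodule.span R C ^ (k + 1)) ≤
        (⨆ k : ℕ, Submodule.span R C ^ (k + 1)).comap (LinearMap.mulLeft R c) from h ht
    refine iSup_le fun k x hx => Submodule.mem_iSup_of_mem (k + 1) ?_
    rw [pow_succ' _ (k + 1)]
    exact Submodule.mul_mem_mul (Submodule.subset_span hc) hx
  | algebraMap r =>
    rw [← Algebra.smul_def]
    exact Submodule.smul_mem _ r ht
  | add x y _ _ hx hy =>
    rw [add_mul]
    exact add_mem (hx ht) (hy ht)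
  | mul x y _ _ hx hy =>
    rw [mul_assoc]
    exact hx (hy ht)

theorem mul_pow_mem_pow {I J : Submodule R K} {b : K} (h : ∀ x ∈ I, x * b ∈ J) (k : ℕ) {x : K}
    (hx : x ∈ I ^ k) : x * b ^ k ∈ J ^ k := by
  induction k generalizing x with
  | zero => simpa using hx
  | succ k ih =>
    rw [pow_succ] at hx
    induction hx using Submodule.mul_induction_on' with
    | mem_mul_mem m hm n hn =>
      have := Submodule.mul_mem_mul (ih hm) (h n hn)
      rw [← pow_succ] at this
      convert this using 1
      ring
    | add x _ y _ hx hy =>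
      rw [add_mul]
      exact add_mem hx hy

/-- Write `1` as a sum of terms in positive powers of `I` and multiply by `b ^ p`: a factor `b ^ k`
carries the term in `I ^ k` into `J ^ k`, leaving `b ^ (p - k)`. -/
theorem isIntegralOverIdeal_of_one_mem {I J : Submodule R K} {b : K}
    (h : ∀ x ∈ I, x * b ∈ J) (h1 : (1 : K) ∈ ⨆ k : ℕ, I ^ (k + 1)) :
    IsIntegralOverIdeal R J b := by
  obtain ⟨f, hf, hsum⟩ := (Submodule.mem_iSup_iff_exists_finsupp _ _).1 h1
  -- The term `f k` lies in `I ^ (k + 1)`, so `p` bounds every degree that occurs.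
  set p := f.support.sup id + 1 with hp
  refine ⟨p, Nat.le_add_left _ _, fun k => f (k - 1) * b ^ k, fun k hk => ?_, ?_⟩
  · obtain ⟨k, rfl⟩ := Nat.exists_eq_add_of_le' (Finset.mem_Icc.1 hk).1
    exact mul_pow_mem_pow h (k + 1) (hf k)
  · have hsub : f.support ⊆ Finset.range p := fun k hk =>
      Finset.mem_range.2 (Nat.lt_succ_of_le (Finset.le_sup (f := id) hk))
    rw [Finsupp.sum_of_support_subset _ hsub _ fun _ _ => rfl] at hsum
    calc b ^ p = ∑ k ∈ Finset.range p, f k * b ^ p := by rw [← Finset.sum_mul, hsum, one_mul]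
      _ = ∑ k ∈ Finset.Icc 1 p, f (k - 1) * b ^ k * b ^ (p - k) := by
        refine Finset.sum_nbij' (· + 1) (· - 1) ?_ ?_ ?_ ?_ ?_ <;>
          simp only [Finset.mem_range, Finset.mem_Icc]
        · intro k hk; omega
        · intro k hk; omega
        · intro k hk; omega
        · intro k hk; omega
        · intro k hk
          rw [mul_assoc, ← pow_add, Nat.add_sub_cancel, Nat.add_sub_cancel' (by omega)]

/-- If all `a` had smaller valuation than `b`, every term on the right of the integral equation
would be strictly smaller than `b ^ p`. Conversely, the quotients `a / b` generate the unit ideal of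
the ring they generate over `R`. -/
theorem isIntegralOverIdeal_iff {A : Finset Kˣ} {b : Kˣ} :
    IsIntegralOverIdeal R (Submodule.span R ((fun a : Kˣ => (a : K)) '' (A : Set Kˣ))) (b : K) ↔
      ∀ V : ValuationOver R K, ∃ a ∈ A, V.1.valuation (b : K) ≤ V.1.valuation (a : K) := by
  constructor
  · rintro ⟨p, hp, c, hc, h⟩ V
    by_contra! hV
    have hb : V.1.valuation (b : K) ≠ 0 := (Valuation.ne_zero_iff _).2 b.ne_zero
    have hI : ∀ x ∈ Submodule.span R ((fun a : Kˣ => (a : K)) '' (A : Set Kˣ)),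
        V.1.valuation x < V.1.valuation (b : K) := fun x hx => by
      refine V.valuation_lt_of_mem_span hb ?_ hx
      rintro _ ⟨a, ha, rfl⟩
      exact hV a ha
    have hlt : V.1.valuation (∑ k ∈ Finset.Icc 1 p, c k * (b : K) ^ (p - k)) <
        V.1.valuation (b : K) ^ p := by
      refine V.1.valuation.map_sum_lt (pow_ne_zero _ hb) fun k hk => ?_
      have hck := hc k hk
      obtain ⟨hk1, hkp⟩ := Finset.mem_Icc.1 hk
      obtain ⟨k, rfl⟩ := Nat.exists_eq_add_of_le' hk1
      conv_rhs => rw [← Nat.add_sub_cancel' hkp, pow_add]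
      rw [map_mul, map_pow]
      exact mul_lt_mul_of_pos_right (V.valuation_lt_of_mem_pow hI k hck)
        (zero_lt_iff.2 (pow_ne_zero _ hb))
    rw [← h, map_pow] at hlt
    exact hlt.false
  · intro h
    set C : Set K := (fun a : Kˣ => (a : K) / b) '' (A : Set Kˣ) with hC
    refine isIntegralOverIdeal_of_one_mem (I := Submodule.span R C) (fun x hx => ?_) ?_
    · induction hx using Submodule.span_induction with
      | mem x hx =>
        obtain ⟨a, ha, rfl⟩ := hx
        rw [div_mul_cancel₀ _ b.ne_zero]
        exact Submodule.subset_span ⟨a, ha, rfl⟩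
      | zero => rw [zero_mul]; exact zero_mem _
      | add x y _ _ hx hy => rw [add_mul]; exact add_mem hx hy
      | smul r x _ hx => rw [smul_mul_assoc]; exact Submodule.smul_mem _ r hx
    -- Otherwise a valuation centred at this ideal would make every `a / b` smaller than `1`.
    · have hI : Ideal.span {s : Algebra.adjoin R C | (s : K) ∈ C} = ⊤ := by
        by_contra hI
        obtain ⟨V, -, hV⟩ := exists_valuationOver _ hI
        obtain ⟨a, ha, hab⟩ := h V
        have haC : (a : K) / b ∈ C := ⟨a, ha, rfl⟩
        have := hV ⟨_, Algebra.subset_adjoin haC⟩ (Ideal.subset_span haC)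
        rw [map_div₀, div_lt_one₀ (zero_lt_iff.2 ((Valuation.ne_zero_iff _).2 b.ne_zero))] at this
        exact this.not_ge hab
      have h1 : (1 : Algebra.adjoin R C) ∈ Ideal.span {s : Algebra.adjoin R C | (s : K) ∈ C} :=
        hI ▸ Submodule.mem_top
      suffices key : ∀ s ∈ Ideal.span {s : Algebra.adjoin R C | (s : K) ∈ C},
          (s : K) ∈ ⨆ k : ℕ, Submodule.span R C ^ (k + 1) from key 1 h1
      intro s hs
      induction hs using Submodule.span_induction with
      | mem s hs =>
        refine Submodule.mem_iSup_of_mem 0 ?_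
        rw [zero_add, pow_one]
        exact Submodule.subset_span hs
      | zero => exact zero_mem _
      | add x y _ _ hx hy => exact add_mem hx hy
      | smul r x _ hx => exact mul_mem_iSup_pow r.2 hx

/-- Valuation rings are integrally closed, and the intersection of those containing the image of `R`
is its integral closure. -/
theorem isIntegral_iff_forall_valuationOver {x : K} :
    IsIntegral R x ↔ ∀ V : ValuationOver R K, V.1.valuation x ≤ 1 := by
  constructor
  · intro h V
    refine (V.1.valuation_le_one_iff x).2 ?_
    let _ : Algebra R V.1 := ((algebraMap R K).codRestrict V.1 V.2).toAlgebra
    have : IsScalarTower R V.1 K := .of_algebraMap_eq fun _ => rfl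
    obtain ⟨y, rfl⟩ := IsIntegrallyClosed.isIntegral_iff.1 (h.tower_top (A := V.1))
    exact y.2
  · intro h
    have hx : x ∈ (⨅ V : {V : ValuationSubring K //
        (((⊥ : Subalgebra R K).toSubring : Subring K) : Set K) ⊆ V.toSubring}, V.1.toSubring) := by
      simp only [Subring.mem_iInf]
      exact fun V => (V.1.valuation_le_one_iff x).1
        (h ⟨V.1, fun r => V.2 (Subalgebra.algebraMap_mem _ r)⟩)
    rw [iInf_valuationSubring_superset, Subring.closure_eq] at hx
    have hx : IsIntegral (⊥ : Subalgebra R K) x := hx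
    have : Algebra.IsIntegral R (⊥ : Subalgebra R K) :=
      Algebra.isIntegral_of_surjective fun ⟨y, hy⟩ => by
        obtain ⟨r, rfl⟩ := Algebra.mem_bot.1 hy
        exact ⟨r, rfl⟩
    exact isIntegral_trans (A := (⊥ : Subalgebra R K)) x hx

end Integrality

end Domain

/-! ### Systems of ideals and soundness of the regularisation -/

section Regularisation

section Systems

variable {G : Type u} [CommGroup G] [PartialOrder G]

theorem IsSystemOfIdeals.mono_of_subset {r : Pf G → G → Prop} (hr : IsSystemOfIdeals r)
    {A B : Pf G} (h : ∀ a ∈ A, a ∈ B) {b : G} (hA : r A b) : r B b := by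
  have : A ∪ B = B := Pf.ext fun a => by
    rw [Pf.mem_union]
    exact ⟨fun ha => ha.elim (h a) id, .inr⟩
  exact this ▸ hr.mono A B b hA

theorem IsSystemOfIdeals.of_mem {r : Pf G → G → Prop} (hr : IsSystemOfIdeals r)
    {A : Pf G} {a : G} (ha : a ∈ A) : r A a :=
  hr.mono_of_subset (fun _ hb => Pf.mem_singleton.1 hb ▸ ha) (hr.refl a)

/-- The elements of `B` are cut one by one; `A` varies in the induction because each pending cut
enlarges it. -/
theorem IsSystemOfIdeals.cut {r : Pf G → G → Prop} (hr : IsSystemOfIdeals r) {A B : Pf G} {c : G}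
    (hA : ∀ b ∈ B, r A b) (hB : r B c) : r A c := by
  suffices h : ∀ (S : Finset G) (A : Pf G), (∀ b ∈ S, r A b) →
      (∀ b ∈ B, b ∈ A ∨ b ∈ S) → r A c from h B.1 A hA fun b hb => .inr hb
  intro S
  induction S using Finset.induction with
  | empty => exact fun A _ hBA => hr.mono_of_subset (fun b hb => by simpa using hBA b hb) hB
  | insert b S _ ih =>
    intro A hS hBA
    refine hr.trans A c b (hS b (Finset.mem_insert_self _ _)) (ih _
      (fun d hd => hr.mono _ _ _ (hS d (Finset.mem_insert_of_mem hd))) fun d hd => ?_)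
    rcases hBA d hd with h | h
    · exact .inl (Pf.mem_union.2 (.inl h))
    · rcases Finset.mem_insert.1 h with rfl | h
      · exact .inl (Pf.mem_union.2 (.inr (Pf.mem_singleton.2 rfl)))
      · exact .inr h

/-- The system of ideals defined by a monotone morphism to a linearly ordered group. -/
theorem isSystemOfIdeals_of_monotone {H : Type v} [CommGroup H] [LinearOrder H]
    [IsOrderedMonoid H] {f : G →* H} (hf : Monotone f) :
    IsSystemOfIdeals fun (A : Pf G) b => ∃ a ∈ A, f a ≤ f b where
  refl a := ⟨a, Pf.mem_singleton.2 rfl, le_rfl⟩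
  mono := fun A A' b ⟨a, ha, hab⟩ => ⟨a, Pf.mem_union.2 (.inl ha), hab⟩
  trans := by
    rintro A b c ⟨a, ha, hac⟩ ⟨a', ha', hab⟩
    rcases Pf.mem_union.1 ha' with ha' | ha'
    · exact ⟨a', ha', hab⟩
    · exact ⟨a, ha, hac.trans (Pf.mem_singleton.1 ha' ▸ hab)⟩
  order a b h := ⟨a, Pf.mem_singleton.2 rfl, hf h⟩
  equivariant := by
    rintro x A b ⟨a, ha, hab⟩
    refine ⟨x * a, Pf.mem_smul.2 ⟨a, ha, rfl⟩, ?_⟩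
    rw [map_mul, map_mul]
    exact mul_le_mul_right hab _

/-- The regularisation of `r` is contained in every linear order compatible with `r`. -/
theorem exists_le_of_regularisation {H : Type v} [CommGroup H] [LinearOrder H]
    [IsOrderedMonoid H] {f : G →* H} (hf : Monotone f) {r : Pf G → G → Prop}
    (hr : ∀ A b, r A b → ∃ a ∈ A, f a ≤ f b) {A B : Pf G} (h : regularisation r A B) :
    ∃ a ∈ A, ∃ b ∈ B, f a ≤ f b := by
  obtain ⟨m, x, hx⟩ := h
  -- These signs make every forced element at least `1` under `f`, so the system defined by `f`
  -- takes part in the definition of `forced`.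
  obtain ⟨c, hc, hc1⟩ := hx (fun i => if 1 ≤ f (x i) then 1 else -1) _
    (isSystemOfIdeals_of_monotone hf) hr (by
      rintro _ ⟨i, rfl⟩
      refine ⟨1, Pf.mem_singleton.2 rfl, ?_⟩
      dsimp only
      split_ifs with hi
      · simpa using hi
      · simpa using (not_le.1 hi).le)
  obtain ⟨a, ha, b, hb, rfl⟩ := Pf.mem_div.1 hc
  rw [map_div, map_one, div_le_one'] at hc1
  exact ⟨a, ha, b, hb, hc1⟩

/-- A finite set of elements can be given arbitrary signs in the definition of the
regularisation. -/
theorem regularisation_of_forced {r : Pf G → G → Prop} {A B : Pf G} (D : Finset G)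
    (h : ∀ Y : Set G, (∀ d ∈ D, d ∈ Y ∨ d⁻¹ ∈ Y) → forced r Y (A / B) 1) :
    regularisation r A B := by
  refine ⟨D.card, fun i => D.equivFin.symm i, fun ε => h _ fun d hd => ?_⟩
  have hd' : ((D.equivFin.symm (D.equivFin ⟨d, hd⟩) : D) : G) = d := by simp
  rcases Int.units_eq_one_or (ε (D.equivFin ⟨d, hd⟩)) with hε | hε
  · exact .inl ⟨_, by dsimp only; rw [hε, hd']; simp⟩
  · exact .inr ⟨_, by dsimp only; rw [hε, hd']; simp⟩

end Systems

theorem exists_forall_rel_of_total {α : Type u} {r : α → α → Prop}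
    (trans : ∀ a b c, r a b → r b c → r a c) {s : Finset α} (hs : s.Nonempty)
    (total : ∀ a ∈ s, ∀ b ∈ s, r a b ∨ r b a) : ∃ a ∈ s, ∀ b ∈ s, r a b := by
  induction hs using Finset.Nonempty.cons_induction with
  | singleton a => exact ⟨a, by simp, fun b hb => by
      rw [Finset.mem_singleton.1 hb]; simpa using total a (by simp) a (by simp)⟩
  | cons a s ha hs ih =>
    obtain ⟨c, hc, hcs⟩ := ih fun x hx y hy =>
      total x (Finset.mem_cons_of_mem hx) y (Finset.mem_cons_of_mem hy)
    have haa := total a (by simp) a (by simp)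
    rcases total a (by simp) c (Finset.mem_cons_of_mem hc) with h | h
    · refine ⟨a, by simp, fun b hb => ?_⟩
      rcases Finset.mem_cons.1 hb with rfl | hb
      · exact haa.elim id id
      · exact trans _ _ _ h (hcs b hb)
    · refine ⟨c, Finset.mem_cons_of_mem hc, fun b hb => ?_⟩
      rcases Finset.mem_cons.1 hb with rfl | hb
      · exact h
      · exact hcs b hb

/-! ### Dedekind ideals and completeness of the regularisation -/

section Dedekind

variable {R : Type u} {K : Type v} [CommRing R] [Field K] [Algebra R K]

theorem DivisibilityGroup.mk_surjective : Function.Surjective (DivisibilityGroup.mk R K) :=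
  QuotientGroup.mk'_surjective _

theorem ValuationOver.exists_hom_le_of_dedekind (V : ValuationOver R K)
    {A : Pf (DivisibilityGroup R K)} {b : DivisibilityGroup R K} (h : dedekind R K A b) :
    ∃ a ∈ A, V.hom a ≤ V.hom b := by
  obtain ⟨u, rfl⟩ := DivisibilityGroup.mk_surjective b
  by_contra! hV
  refine (V.valuation_lt_of_mem_span ((Valuation.ne_zero_iff _).2 u.ne_zero) ?_ (h u rfl)).false
  rintro _ ⟨w, hw, rfl⟩
  exact V.hom_mk_lt_iff.1 (hV _ hw)

variable [IsFractionRing R K]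

/-- The elements of `K` generated by `A` for a system of ideals, together with `0`. -/
def generated {r : Pf (DivisibilityGroup R K) → DivisibilityGroup R K → Prop}
    (hr : IsSystemOfIdeals r) (hd : ∀ A b, dedekind R K A b → r A b)
    (A : Pf (DivisibilityGroup R K)) : Submodule R K where
  carrier := {x | ∀ u : Kˣ, (u : K) = x → r A (DivisibilityGroup.mk R K u)}
  zero_mem' u hu := (u.ne_zero hu).elim
  add_mem' := by
    intro x y hx hy u hu
    by_cases hx0 : x = 0
    · exact hy u (by rw [hu, hx0, zero_add])
    by_cases hy0 : y = 0
    · exact hx u (by rw [hu, hy0, add_zero])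
    refine hr.cut (B := {DivisibilityGroup.mk R K (Units.mk0 x hx0)} ∪
      {DivisibilityGroup.mk R K (Units.mk0 y hy0)}) (fun b hb => ?_) (hd _ _ fun w hw => ?_)
    · rcases Pf.mem_union.1 hb with hb | hb
      · exact Pf.mem_singleton.1 hb ▸ hx _ rfl
      · exact Pf.mem_singleton.1 hb ▸ hy _ rfl
    -- `dedekind` asks for every representative `w` of the class of `u`; each is an `R`-multiple of
    -- `u = x + y`.
    · obtain ⟨r, hr⟩ := (DivisibilityGroup.mk_le_mk R K u w).1 hw.ge
      rw [hr, hu, ← Algebra.smul_def]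
      refine Submodule.smul_mem _ r (add_mem (Submodule.subset_span ⟨Units.mk0 x hx0, ?_, rfl⟩)
        (Submodule.subset_span ⟨Units.mk0 y hy0, ?_, rfl⟩))
      · exact Set.mem_ofPred.2 <| Pf.mem_union.2 (.inl (Pf.mem_singleton.2 rfl))
      · exact Set.mem_ofPred.2 <| Pf.mem_union.2 (.inr (Pf.mem_singleton.2 rfl))
  smul_mem' := by
    intro c x hx u hu
    have hx0 : x ≠ 0 := by
      rintro rfl
      exact u.ne_zero (by rw [hu, smul_zero])
    refine hr.cut (B := {DivisibilityGroup.mk R K (Units.mk0 x hx0)})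
      (fun b hb => Pf.mem_singleton.1 hb ▸ hx _ rfl)
      (hr.order _ _ ((DivisibilityGroup.mk_le_mk R K _ _).2 ⟨c, ?_⟩))
    rw [hu, Algebra.smul_def, Units.val_mk0]

/-- Translating `1 ▷ y` gives `x ▷ y x`, so forcing `Y` turns the generated `R`-module into a module
over `R[Y]`. -/
theorem mul_mem_generated {r : Pf (DivisibilityGroup R K) → DivisibilityGroup R K → Prop}
    (hr : IsSystemOfIdeals r) (hd : ∀ A b, dedekind R K A b → r A b)
    (A : Pf (DivisibilityGroup R K)) {Y : Set (DivisibilityGroup R K)} (hY : ∀ y ∈ Y, r {1} y)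
    {s x : K}
    (hs : s ∈ Algebra.adjoin R ((fun u : Kˣ => (u : K)) '' {u | DivisibilityGroup.mk R K u ∈ Y}))
    (hx : x ∈ generated hr hd A) : s * x ∈ generated hr hd A := by
  induction hs using Algebra.adjoin_induction generalizing x with
  | mem s hs =>
    obtain ⟨y, hy, rfl⟩ := hs
    intro u hu
    have hx' := hx (y⁻¹ * u) (by
      rw [Units.val_mul, hu, ← mul_assoc, Units.inv_mul, one_mul])
    refine hr.cut (B := {_}) (fun b hb => Pf.mem_singleton.1 hb ▸ hx') ?_
    have h := hr.equivariant (DivisibilityGroup.mk R K (y⁻¹ * u)) {1} _ (hY _ hy)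
    rw [← map_mul, mul_comm (y⁻¹ * u), mul_inv_cancel_left] at h
    refine hr.mono_of_subset (fun a ha => ?_) h
    obtain ⟨c, hc, rfl⟩ := Pf.mem_smul.1 ha
    rw [Pf.mem_singleton.1 hc, mul_one]
    exact Pf.mem_singleton.2 rfl
  | algebraMap r =>
    rw [← Algebra.smul_def]
    exact Submodule.smul_mem _ r hx
  | add x y _ _ hx' hy' =>
    rw [add_mul]
    exact add_mem (hx' hx) (hy' hx)
  | mul x y _ _ hx' hy' =>
    rw [mul_assoc]
    exact hx' (hy' hx)

/-- The signs on quotients make divisibility over `S = R[Y]` total on `C`, and those on elements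
decide whether its least element `c` or `c⁻¹` lies in `S`. The valuations force `c⁻¹ ∈ S` in either
case. -/
theorem forced_dedekind_one {C : Pf (DivisibilityGroup R K)}
    (hC : ∀ V : ValuationOver R K, ∃ c ∈ C, V.hom c ≤ 1) {Y : Set (DivisibilityGroup R K)}
    (h₁ : ∀ c ∈ C, c ∈ Y ∨ c⁻¹ ∈ Y) (h₂ : ∀ c ∈ C, ∀ d ∈ C, c / d ∈ Y ∨ d / c ∈ Y) :
    forced (dedekind R K) Y C 1 := by
  intro r hr hd hY
  obtain ⟨ρ, hρ⟩ := (DivisibilityGroup.mk_surjective (R := R) (K := K)).hasRightInverse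
  set S := Algebra.adjoin R ((fun u : Kˣ => (u : K)) '' {u | DivisibilityGroup.mk R K u ∈ Y})
  have hS {u : Kˣ} (hu : DivisibilityGroup.mk R K u ∈ Y) : (u : K) ∈ S :=
    Algebra.subset_adjoin ⟨u, hu, rfl⟩
  -- Every element of `C` is an `S`-multiple of `c`.
  obtain ⟨c, hcC, hc⟩ := exists_forall_rel_of_total
    (r := fun c d => ((ρ d / ρ c : Kˣ) : K) ∈ S) (fun a b c hab hbc => by
      have := mul_mem hbc hab
      rwa [← Units.val_mul, div_mul_div_cancel] at this) C.2 (fun a ha b hb => by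
      rcases h₂ b hb a ha with h | h
      · exact .inl (hS (by rwa [map_div, hρ, hρ]))
      · exact .inr (hS (by rwa [map_div, hρ, hρ])))
  have hinv : ((ρ c)⁻¹ : K) ∈ S := by
    rcases h₁ c hcC with h | h
    · have hcS : (ρ c : K) ∈ S := hS (by rwa [hρ])
      by_cases hI : Ideal.span {(⟨ρ c, hcS⟩ : S)} = ⊤
      · obtain ⟨s, hs⟩ := Ideal.mem_span_singleton'.1 (hI ▸ Submodule.mem_top (x := (1 : S)))
        rw [← eq_inv_of_mul_eq_one_left (congrArg Subtype.val hs)]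
        exact s.2
      -- If `c` is not a unit of `S`, some valuation is at most `1` on `S` and less than `1` at `c`,
      -- hence at all its multiples `d ∈ C`, against `hC`.
      · obtain ⟨V, hVS, hV⟩ := exists_valuationOver S hI
        obtain ⟨d, hdC, hd1⟩ := hC V
        have hlt := hV _ (Ideal.mem_span_singleton_self _)
        rw [← hρ d, ← map_one V.hom, ← map_one (DivisibilityGroup.mk R K), V.hom_mk_le_iff,
          Units.val_one, map_one] at hd1
        refine absurd hd1 (not_le.2 ?_)
        have hle := hVS _ (hc d hdC)
        calc V.1.valuation (ρ d) = V.1.valuation ((ρ d / ρ c : Kˣ) : K) * V.1.valuation (ρ c) := by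
              rw [← map_mul, ← Units.val_mul, div_mul_cancel]
          _ ≤ V.1.valuation (ρ c) := mul_le_of_le_one_left' hle
          _ < 1 := hlt
    · have := hS (u := (ρ c)⁻¹) (by rwa [map_inv, hρ])
      rwa [Units.val_inv_eq_inv_val] at this
  have hcN : (ρ c : K) ∈ generated hr hd C := fun u hu => by
    rw [Units.ext hu, hρ]
    exact hr.of_mem hcC
  have := mul_mem_generated hr hd C hY hinv hcN
  rw [inv_mul_cancel₀ (ρ c).ne_zero] at this
  simpa using this 1 rfl

theorem regularisation_dedekind_iff (A B : Pf (DivisibilityGroup R K)) :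
    regularisation (dedekind R K) A B ↔
      SemanticEntailment (fun V : ValuationOver R K => V.hom) A B := by
  refine ⟨fun h V => exists_le_of_regularisation V.hom_monotone
    (fun _ _ => V.exists_hom_le_of_dedekind) h, fun h => ?_⟩
  -- Signs are needed for the elements of `A / B` and for their pairwise quotients.
  refine regularisation_of_forced ((A / B).1 ∪ (A / B).1 / (A / B).1) fun Y hY =>
    forced_dedekind_one (fun V => ?_) (fun c hc => hY c (Finset.mem_union_left _ hc))
      fun c hc d hd => ?_
  · obtain ⟨a, ha, b, hb, hab⟩ := h V
    refine ⟨a / b, Pf.mem_div.2 ⟨a, ha, b, hb, rfl⟩, ?_⟩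
    rw [map_div, div_le_one']
    exact hab
  · have := hY _ (Finset.mem_union_right _ (Finset.div_mem_div hc hd))
    rwa [inv_div] at this

theorem toLor_le_toLor_iff (A : Finset Kˣ) (hA : A.Nonempty) (b : Kˣ) :
    A.inf' hA (fun a => toLor R K (DivisibilityGroup.mk R K a)) ≤
        toLor R K (DivisibilityGroup.mk R K b) ↔
      ∀ V : ValuationOver R K, ∃ a ∈ A, V.1.valuation (b : K) ≤ V.1.valuation (a : K) := by
  rw [← GeneratedLattice.lift_le_lift regularisation_dedekind_iff, map_finset_inf', Pi.le_def]
  refine forall_congr' fun V => ?_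
  rw [Finset.inf'_apply, Finset.inf'_le_iff]
  exact exists_congr fun a => and_congr_right fun _ => V.hom_mk_le_iff

theorem toLor_mk_le_iff_isIntegral (a b : Kˣ) :
    toLor R K (DivisibilityGroup.mk R K a) ≤ toLor R K (DivisibilityGroup.mk R K b) ↔
      IsIntegral R ((b : K) / a) := by
  have h := toLor_le_toLor_iff (R := R) {a} (Finset.singleton_nonempty a) b
  rw [Finset.inf'_singleton] at h
  rw [h, isIntegral_iff_forall_valuationOver]
  refine forall_congr' fun V => ?_
  rw [map_div₀, div_le_one₀ (zero_lt_iff.2 ((Valuation.ne_zero_iff _).2 a.ne_zero))]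
  simp

theorem toLor_monotone : Monotone (toLor R K) := fun a b h =>
  GeneratedLattice.le_of_rel ((regularisation_dedekind_iff {a} {b}).2
    fun V => ⟨a, Pf.mem_singleton.2 rfl, b, Pf.mem_singleton.2 rfl, V.hom_monotone h⟩)
    (fun _ hc => Pf.mem_singleton.1 hc ▸ le_rfl) fun _ hc => Pf.mem_singleton.1 hc ▸ le_rfl

/-- The order pulled back from `Lor R K` says that `b / a` is integral over `R`, divisibility says
that `b / a` lies in `R`; they agree iff `R` is integrally closed. -/
theorem toLor_embedding_iff :
    (Function.Injective (toLor R K) ∧ ∀ a b, toLor R K a ≤ toLor R K b ↔ a ≤ b) ↔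
      IsIntegrallyClosed R := by
  rw [isIntegrallyClosed_iff K]
  constructor
  · rintro ⟨-, h⟩ x hx
    by_cases hx0 : x = 0
    · exact ⟨0, by rw [map_zero, hx0]⟩
    obtain ⟨r, hr⟩ := (DivisibilityGroup.mk_le_mk R K 1 (Units.mk0 x hx0)).1
      ((h _ _).1 ((toLor_mk_le_iff_isIntegral _ _).2 (by simpa using hx)))
    exact ⟨r, by simpa using hr.symm⟩
  · intro h
    have hle (a b) : toLor R K a ≤ toLor R K b ↔ a ≤ b := by
      refine ⟨fun hab => ?_, fun hab => toLor_monotone hab⟩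
      obtain ⟨a, rfl⟩ := DivisibilityGroup.mk_surjective a
      obtain ⟨b, rfl⟩ := DivisibilityGroup.mk_surjective b
      obtain ⟨r, hr⟩ := h ((toLor_mk_le_iff_isIntegral _ _).1 hab)
      exact (DivisibilityGroup.mk_le_mk R K _ _).2
        ⟨r, by rw [hr, div_mul_cancel₀ _ a.ne_zero]⟩
    exact ⟨fun a b hab => le_antisymm ((hle _ _).1 hab.le) ((hle _ _).1 hab.ge), hle⟩

end Dedekind

end Regularisation

end

end LorenzenDivisor

open LorenzenDivisor in
theorem mainTheorem7 {R : Type*} {K : Type*} [CommRing R] [IsDomain R] [Field K] [Algebra R K]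
    [IsFractionRing R K] :
    -- the regularisation of the system of Dedekind ideals is a regular entailment relation
    IsRegularEntailment (regularisation (dedekind R K)) ∧
    -- the distributive lattice it generates is in a unique way a lattice-ordered group such that
    -- the natural map is a morphism of groups, and this map preserves the order
    (∃! g : CommGroup (Lor R K), IsLorenzenGroupLaw R K g) ∧
    Monotone (toLor R K) ∧
    -- the ideal Lorenzen gcd
    (∀ (A : Finset Kˣ) (hA : A.Nonempty) (b : Kˣ),
      A.inf' hA (fun a => toLor R K (DivisibilityGroup.mk R K a)) ≤
          toLor R K (DivisibilityGroup.mk R K b) ↔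
        IsIntegralOverIdeal R (Submodule.span R ((fun a : Kˣ => (a : K)) '' (A : Set Kˣ)))
          (b : K)) ∧
    -- the natural map is an embedding of ordered groups iff the domain is integrally closed
    ((Function.Injective (toLor R K) ∧ ∀ a b, toLor R K a ≤ toLor R K b ↔ a ≤ b) ↔
      IsIntegrallyClosed R) := by
  refine ⟨?_, ?_, toLor_monotone, fun A hA b => ?_, toLor_embedding_iff⟩
  · have h : regularisation (dedekind R K) =
        SemanticEntailment fun V : ValuationOver R K => V.hom :=
      funext fun A => funext fun B => propext (regularisation_dedekind_iff A B)
    rw [h]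
    exact isRegularEntailment_semanticEntailment fun V => V.hom_monotone
  · obtain ⟨g, hg, huniq⟩ := GeneratedLattice.existsUnique_commGroup
      (regularisation_dedekind_iff (R := R) (K := K))
    exact ⟨g, ⟨hg.1, hg.2⟩, fun g' hg' => huniq g' ⟨hg'.1, hg'.2⟩⟩
  · exact (toLor_le_toLor_iff A hA b).trans isIntegralOverIdeal_iff.symm
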